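/- Let $N\in\mathbb{N}$ and $p\in(1,\infty)$. For a non-empty open set $\Omega\subset\mathbb{R}^N$ let $W^{1,p}(\Omega)$ be the space of all $\mathsf u\in L^p(\Omega)$ whose weak first-order partial derivatives belong to $L^p(\Omega)$, with the norm $\|\mathsf u\|_{W^{1,p}(\Omega)}^p=\|\mathsf u\|_{L^p(\Omega)}^p+\sum_{i=1}^N\|\partial_i\mathsf u\|_{L^p(\Omega)}^p$, and let $\tilde W^{1,p}(\Omega)$ be the closure in $W^{1,p}(\Omega)$ of the set of those elements of $W^{1,p}(\Omega)$ that are restrictions to $\Omega$ of continuous functions on $\overline\Omega$ with compact support. For $A\subset\overline\Omega$ let \[ \operatorname{Cap}_{p,\Omega}(A):=\inf\left\{\|\mathsf u\|_{W^{1,p}(\Omega)}^p:\ \mathsf u\in\tilde W^{1,p}(\Omega),\ \mathsf u\ge 1 \text{ a.e. on } O\cap\Omega \text{ for some } O\supset A \text{ open in } \overline\Omega\right\}\in[0,\infty]. \] A function $u:D\to\mathbb{R}$ on a set $D\subset\overline\Omega$ is called $\operatorname{Cap}_{p,\Omega}$-quasi continuous if for every $\varepsilon>0$ there is a set $O$,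 open in $\overline\Omega$, with $\operatorname{Cap}_{p,\Omega}(O)<\varepsilon$ such that the restriction of $u$ to $D\setminus O$ is continuous. Let $U\subset V\subset\mathbb{R}^N$ be non-empty open sets and let $u:U\to\mathbb{R}$ be a function. Then $u$ is $\operatorname{Cap}_{p,U}$-quasi continuous if and only if $u$ is $\operatorname{Cap}_{p,V}$-quasi continuous. -/

import Mathlib

open MeasureTheory TopologicalSpace
open scoped ENNReal Distributions CompactlySupported

noncomputable section

namespace RelCap

/-- `g` is the weak `i`-th partial derivative of `u` on the open set `Ω ⊆ ℝ^N`. It is only used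
for `u, g ∈ L^p(Ω)`, where all the integrals below converge. -/
def HasWeakPartialDeriv {N : ℕ} (Ω : Opens (EuclideanSpace ℝ (Fin N))) (i : Fin N)
    (u g : EuclideanSpace ℝ (Fin N) → ℝ) : Prop :=
  ∀ φ : 𝓓(Ω, ℝ),
    ∫ x in (Ω : Set (EuclideanSpace ℝ (Fin N))),
        u x * fderiv ℝ φ x (EuclideanSpace.single i (1 : ℝ)) =
      - ∫ x in (Ω : Set (EuclideanSpace ℝ (Fin N))), g x * φ x

/-- The space `L^p(Ω)^{N+1}` with the norm `(∑ j, ‖w j‖_{L^p(Ω)}^p)^{1/p}`. The index `none` stands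
for the multi-index `0`, and `some i` for the `i`-th unit multi-index. -/
abbrev LpJet {N : ℕ} (p : ℝ≥0∞) (Ω : Opens (EuclideanSpace ℝ (Fin N))) : Type :=
  PiLp p (fun _ : Option (Fin N) =>
    Lp ℝ p ((volume : Measure (EuclideanSpace ℝ (Fin N))).restrict Ω))

/-- The Sobolev space `W^{1,p}(Ω)`. A function `u` is represented by the tuple
`(u, ∂₁u, …, ∂_N u)` of its weak derivatives of order at most one, which `u` determines, so that
the norm inherited from `L^p(Ω)^{N+1}` is the one of `W^{1,p}(Ω)`. -/
def sobolev {N : ℕ} (p : ℝ≥0∞) (Ω : Opens (EuclideanSpace ℝ (Fin N))) : Set (LpJet p Ω) :=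
  {w | ∀ i : Fin N, HasWeakPartialDeriv Ω i (w none) (w (some i))}

/-- `W^{1,p}(Ω) ∩ C_c(closure Ω)`: the elements of `W^{1,p}(Ω)` that are restrictions to `Ω` of
continuous functions on `closure Ω` with compact support. -/
def sobolevCc {N : ℕ} (p : ℝ≥0∞) (Ω : Opens (EuclideanSpace ℝ (Fin N))) : Set (LpJet p Ω) :=
  {w | w ∈ sobolev p Ω ∧
    ∃ f : C_c(closure (Ω : Set (EuclideanSpace ℝ (Fin N))), ℝ),
      ∀ᵐ x ∂((volume : Measure (EuclideanSpace ℝ (Fin N))).restrict Ω),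
        ∀ hx : x ∈ closure (Ω : Set (EuclideanSpace ℝ (Fin N))), w none x = f ⟨x, hx⟩}

/-- The closure of `W^{1,p}(Ω) ∩ C_c(closure Ω)` in `W^{1,p}(Ω)`. -/
def sobolevTilde {N : ℕ} (p : ℝ≥0∞) [Fact (1 ≤ p)] (Ω : Opens (EuclideanSpace ℝ (Fin N))) :
    Set (LpJet p Ω) :=
  sobolev p Ω ∩ closure (sobolevCc p Ω)

/-- `O` is a relatively open subset of `closure Ω`. -/
def IsOpenInClosure {N : ℕ} (Ω : Opens (EuclideanSpace ℝ (Fin N)))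
    (O : Set (EuclideanSpace ℝ (Fin N))) : Prop :=
  ∃ G : Set (EuclideanSpace ℝ (Fin N)), IsOpen G ∧ O = G ∩ closure (Ω : Set _)

/-- The functions in the closure of `W^{1,p}(Ω) ∩ C_c(closure Ω)` that are at least `1` almost
everywhere on `O ∩ Ω` for some relatively open subset `O` of `closure Ω` containing `A`. -/
def admissible {N : ℕ} (p : ℝ≥0∞) [Fact (1 ≤ p)] (Ω : Opens (EuclideanSpace ℝ (Fin N)))
    (A : Set (EuclideanSpace ℝ (Fin N))) : Set (LpJet p Ω) :=
  {w | w ∈ sobolevTilde p Ω ∧ ∃ O : Set (EuclideanSpace ℝ (Fin N)),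
    IsOpenInClosure Ω O ∧ A ⊆ O ∧
      ∀ᵐ x ∂((volume : Measure (EuclideanSpace ℝ (Fin N))).restrict (O ∩ Ω)), 1 ≤ w none x}

/-- The relative `p`-capacity of `A ⊆ closure Ω` with respect to `Ω`
(`∞` if there is no admissible function). -/
def relCap {N : ℕ} (p : ℝ≥0∞) [Fact (1 ≤ p)] (Ω : Opens (EuclideanSpace ℝ (Fin N)))
    (A : Set (EuclideanSpace ℝ (Fin N))) : ℝ≥0∞ :=
  ⨅ w ∈ admissible p Ω A, ‖w‖ₑ ^ p.toReal

/-- Quasi continuity, with respect to the relative `p`-capacity of `Ω`, of a real function `u`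
on a set `D ⊆ closure Ω`. -/
def QuasiContinuous {N : ℕ} (p : ℝ≥0∞) [Fact (1 ≤ p)] (Ω : Opens (EuclideanSpace ℝ (Fin N)))
    {D : Set (EuclideanSpace ℝ (Fin N))} (u : D → ℝ) : Prop :=
  ∀ ε : ℝ≥0∞, 0 < ε → ∃ O : Set (EuclideanSpace ℝ (Fin N)),
    IsOpenInClosure Ω O ∧ relCap p Ω O < ε ∧
      ContinuousOn u {x : D | (x : EuclideanSpace ℝ (Fin N)) ∉ O}

end RelCap

end

/-!
A function on `V` restricts to `U` with a smaller norm, so quasi continuity with respect to `V`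
passes to `U`.

Conversely, multiplication by a cut-off function `η` that equals `1` near a compact set `K ⊆ U`
carries functions on `U` to functions on `V`, so on subsets of `K` the capacity of `V` is at most a
constant times that of `U`. Given `ε`, exhaust `U` by compact sets `K n` and take exceptional sets
`O n` for `u` whose capacity with respect to `U` is small compared with the constant of `K n`. Since
continuity is a local property, `⋃ n, O n ∩ interior (K n)` is an exceptional set for `u` as well,
and its capacity with respect to `V` is less than `ε` by countable subadditivity.

Countable subadditivity holds because admissible functions can be taken nonnegative, so that their
sum is admissible for the union. To make a function nonnegative, write it as a series of continuous
functions and replace each term `v` by a smooth approximation of `|v|`, which does not increase the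
Sobolev norm.
-/

noncomputable section

namespace RelCap

open Filter Topology ContinuousLinearMap
open scoped Convolution Manifold NNReal

section TestFunction

variable {E F : Type*} [NormedAddCommGroup E] [NormedSpace ℝ E] [NormedAddCommGroup F]
  [NormedSpace ℝ F] {Ω : Opens E}

theorem testFunction_eq_zero (φ : 𝓓(Ω, F)) {x : E} (hx : x ∉ Ω) : φ x = 0 :=
  image_eq_zero_of_notMem_tsupport fun h => hx (φ.tsupport_subset h)

theorem fderiv_testFunction_eq_zero (φ : 𝓓(Ω, F)) {x : E} (hx : x ∉ Ω) : fderiv ℝ φ x = 0 :=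
  image_eq_zero_of_notMem_tsupport fun h => hx (φ.tsupport_subset (tsupport_fderiv_subset ℝ h))

theorem continuous_fderiv_testFunction_apply (φ : 𝓓(Ω, F)) (e : E) :
    Continuous fun x => fderiv ℝ φ x e :=
  (φ.contDiff.continuous_fderiv (by simp)).clm_apply continuous_const

theorem hasCompactSupport_fderiv_testFunction_apply (φ : 𝓓(Ω, F)) (e : E) :
    HasCompactSupport fun x => fderiv ℝ φ x e :=
  φ.hasCompactSupport.fderiv_apply ℝ e

theorem exists_testFunction_eventuallyEq_one [FiniteDimensional ℝ E] {K : Set E}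
    (hK : IsCompact K) (hKΩ : K ⊆ Ω) : ∃ η : 𝓓(Ω, ℝ), η =ᶠ[𝓝ˢ K] 1 := by
  obtain ⟨L, hL, hKL, hLΩ⟩ := exists_compact_between hK Ω.isOpen hKΩ
  obtain ⟨η, hη1, hη0, -⟩ :=
    exists_contMDiffMap_one_nhds_of_subset_interior (n := ⊤) 𝓘(ℝ, E) hK.isClosed hKL
  have hsupp : tsupport η ⊆ L :=
    closure_minimal (fun x hx => by_contra fun hxL => hx (hη0 x hxL)) hL.isClosed
  exact ⟨⟨η, η.contMDiff.contDiff, .of_isClosed_subset hL (isClosed_tsupport _) hsupp,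
    hsupp.trans hLΩ⟩, hη1⟩

end TestFunction

section Mollification

theorem exists_contDiffBump_tendsto_rOut (E : Type*) [NormedAddCommGroup E] :
    ∃ ρ : ℕ → ContDiffBump (0 : E), Tendsto (fun n => (ρ n).rOut) atTop (𝓝 0) :=
  ⟨fun n => ⟨1 / (n + 1 : ℝ) / 2, 1 / (n + 1 : ℝ), by positivity, half_lt_self (by positivity)⟩,
    tendsto_one_div_add_atTop_nhds_zero_nat⟩

variable {E : Type*} [NormedAddCommGroup E] [NormedSpace ℝ E] [FiniteDimensional ℝ E]
  [MeasurableSpace E] [BorelSpace E] {μ : Measure E} [μ.IsAddHaarMeasure]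

theorem fderiv_convolution_apply_eq_neg_integral {ρ v : E → ℝ} (hρ : ContDiff ℝ 1 ρ)
    (hρc : HasCompactSupport ρ) (hv : LocallyIntegrable v μ) (x e : E) :
    fderiv ℝ (ρ ⋆[lsmul ℝ ℝ, μ] v) x e = -∫ t, v t * fderiv ℝ (fun t => ρ (x - t)) t e ∂μ := by
  have hreflect (t : E) : fderiv ℝ (fun t => ρ (x - t)) t e = -fderiv ℝ ρ (x - t) e := by
    have hρd : HasFDerivAt ρ (fderiv ℝ ρ (x - t)) (x - t) :=
      (hρ.differentiable one_ne_zero _).hasFDerivAt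
    have hcomp := (hρd.comp t ((hasFDerivAt_id t).const_sub x)).fderiv
    rw [Function.comp_def] at hcomp
    simp [hcomp]
  have hint := ((hρc.fderiv ℝ).convolutionExists_left ((lsmul ℝ ℝ).precompL E)
    (hρ.continuous_fderiv one_ne_zero) hv x).integrable_swap
  rw [(hρc.hasFDerivAt_convolution_left (lsmul ℝ ℝ) hρ hv x).fderiv, convolution_eq_swap,
    ContinuousLinearMap.integral_apply hint]
  simp [hreflect, integral_neg, mul_comm]

theorem abs_normed_convolution_le (ρ : ContDiffBump (0 : E)) {v : E → ℝ} {M : ℝ}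
    (hM : ∀ x, |v x| ≤ M) (x : E) : |(ρ.normed μ ⋆[lsmul ℝ ℝ, μ] v) x| ≤ M := by
  have hbound (t : E) : ‖lsmul ℝ ℝ (ρ.normed μ t) (v (x - t))‖ ≤ ρ.normed μ t * M := by
    simp only [lsmul_apply, smul_eq_mul, norm_mul, Real.norm_eq_abs,
      abs_of_nonneg (ρ.nonneg_normed t)]
    exact mul_le_mul_of_nonneg_left (hM _) (ρ.nonneg_normed t)
  have h := norm_integral_le_of_norm_le (ρ.integrable_normed.mul_const M)
    (Eventually.of_forall hbound)
  rwa [integral_mul_const, ρ.integral_normed, one_mul] at h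

theorem integral_mul_normed_convolution (ρ : ContDiffBump (0 : E)) {ψ g : E → ℝ}
    (hψ : Integrable ψ μ) (hg : Integrable g μ) :
    ∫ x, ψ x * (ρ.normed μ ⋆[lsmul ℝ ℝ, μ] g) x ∂μ =
      ∫ y, g y * (ρ.normed μ ⋆[lsmul ℝ ℝ, μ] ψ) y ∂μ := by
  obtain ⟨C, hC⟩ := ρ.continuous_normed (μ := μ).bounded_above_of_compact_support
    ρ.hasCompactSupport_normed
  have hint : Integrable (fun z : E × E => ρ.normed μ (z.1 - z.2) * (ψ z.1 * g z.2))
      (μ.prod μ) := by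
    refine (hψ.mul_prod hg).bdd_mul (c := C) ?_ (Eventually.of_forall fun z => hC _)
    exact (ρ.continuous_normed.comp (continuous_fst.sub continuous_snd)).aestronglyMeasurable
  have hswap := integral_integral_swap (f := fun x y => ρ.normed μ (x - y) * (ψ x * g y)) hint
  simp only [convolution_eq_swap, lsmul_apply, smul_eq_mul, ← integral_const_mul]
  convert hswap using 1
  · congr! 4
    ring
  · congr! 4 with y
    rw [← ρ.normed_neg, neg_sub]
    ring

theorem tendsto_uncurry_normed_convolution {ρ : ℕ → ContDiffBump (0 : E)}
    (hρ : Tendsto (fun n => (ρ n).rOut) atTop (𝓝 0)) {v : E → ℝ} (hv : Continuous v) (x : E) :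
    Tendsto (Function.uncurry fun n => (ρ n).normed μ ⋆[lsmul ℝ ℝ, μ] v) (atTop ×ˢ 𝓝 x)
      (𝓝 (v x)) :=
  ContDiffBump.convolution_tendsto_right (hρ.comp tendsto_fst)
    (Eventually.of_forall fun _ => hv.aestronglyMeasurable) ((hv.tendsto x).comp tendsto_snd)
    tendsto_snd

end Mollification

section ChainRuleForMollifications

variable {E : Type*} [NormedAddCommGroup E] [NormedSpace ℝ E] [FiniteDimensional ℝ E]
  [MeasurableSpace E] [BorelSpace E] {μ : Measure E} [μ.IsAddHaarMeasure]
  {ρ : ℕ → ContDiffBump (0 : E)} {v : E → ℝ} {M : ℝ}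

theorem integral_comp_mul_fderiv_eq_neg {Ψ : ℝ → ℝ} (hΨ : ContDiff ℝ 1 Ψ) (hv : ContDiff ℝ 1 v)
    {φ : E → ℝ} (hφ : ContDiff ℝ 1 φ) (hφc : HasCompactSupport φ) (e : E) :
    ∫ x, Ψ (v x) * fderiv ℝ φ x e ∂μ = -∫ x, deriv Ψ (v x) * φ x * fderiv ℝ v x e ∂μ := by
  have hΨv : ContDiff ℝ 1 fun x => Ψ (v x) := hΨ.comp hv
  have hchain (x : E) :
      fderiv ℝ (fun x => Ψ (v x)) x e * φ x = deriv Ψ (v x) * φ x * fderiv ℝ v x e := by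
    have h := ((hΨ.differentiable one_ne_zero (v x)).hasDerivAt.comp_hasFDerivAt x
      (hv.differentiable one_ne_zero x).hasFDerivAt).fderiv
    rw [Function.comp_def] at h
    rw [h, smul_apply, smul_eq_mul]
    ring
  simp only [← hchain]
  refine integral_mul_fderiv_eq_neg_fderiv_mul_of_integrable ?_ ?_ ?_
    (fun x _ => hΨv.differentiable one_ne_zero x) fun x _ => hφ.differentiable one_ne_zero x
  · exact (((hΨv.continuous_fderiv one_ne_zero).clm_apply continuous_const).mul
      hφ.continuous).integrable_of_hasCompactSupport hφc.mul_left
  · exact (hΨv.continuous.mul ((hφ.continuous_fderiv one_ne_zero).clm_apply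
      continuous_const)).integrable_of_hasCompactSupport (hφc.fderiv_apply ℝ e).mul_left
  · exact (hΨv.continuous.mul hφ.continuous).integrable_of_hasCompactSupport hφc.mul_left

theorem exists_abs_le_of_continuous {Θ : ℝ → ℝ} (hΘ : Continuous Θ) (M : ℝ) :
    ∃ C, ∀ t, |t| ≤ M → |Θ t| ≤ C := by
  obtain ⟨C, hC⟩ :=
    (isCompact_Icc (a := -M) (b := M)).exists_bound_of_continuousOn hΘ.continuousOn
  exact ⟨C, fun t ht => hC t (abs_le.1 ht)⟩

theorem continuous_normed_convolution (ρ : ContDiffBump (0 : E)) (hv : LocallyIntegrable v μ) :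
    Continuous (ρ.normed μ ⋆[lsmul ℝ ℝ, μ] v) :=
  ρ.hasCompactSupport_normed.continuous_convolution_left _ ρ.continuous_normed hv

theorem tendsto_integral_comp_normed_convolution_mul
    (hρ : Tendsto (fun n => (ρ n).rOut) atTop (𝓝 0)) (hv : Continuous v) (hM : ∀ x, |v x| ≤ M)
    {Θ : ℝ → ℝ} (hΘ : Continuous Θ) {k : E → ℝ} (hk : Integrable k μ) :
    Tendsto (fun n => ∫ x, Θ (((ρ n).normed μ ⋆[lsmul ℝ ℝ, μ] v) x) * k x ∂μ) atTop
      (𝓝 (∫ x, Θ (v x) * k x ∂μ)) := by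
  obtain ⟨C, hC⟩ := exists_abs_le_of_continuous hΘ M
  refine tendsto_integral_of_dominated_convergence (fun x => C * ‖k x‖) (fun n => ?_)
    (hk.norm.const_mul _) (fun n => Eventually.of_forall fun x => ?_)
    (Eventually.of_forall fun x => ?_)
  · exact (hΘ.comp (continuous_normed_convolution _
      hv.locallyIntegrable)).aestronglyMeasurable.mul hk.aestronglyMeasurable
  · rw [norm_mul]
    exact mul_le_mul_of_nonneg_right (hC _ (abs_normed_convolution_le _ hM x)) (norm_nonneg _)
  · exact ((hΘ.tendsto _).comp
      (ContDiffBump.convolution_tendsto_right_of_continuous hρ hv x)).mul_const _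

theorem tendsto_integral_mul_normed_convolution_comp_mul
    (hρ : Tendsto (fun n => (ρ n).rOut) atTop (𝓝 0)) (hv : Continuous v) (hM : ∀ x, |v x| ≤ M)
    {Θ : ℝ → ℝ} (hΘ : Continuous Θ) {φ : E → ℝ} (hφ : Continuous φ) (hφc : HasCompactSupport φ)
    {g : E → ℝ} (hg : Integrable g μ) :
    Tendsto (fun n => ∫ x, g x * ((ρ n).normed μ ⋆[lsmul ℝ ℝ, μ]
        fun y => Θ (((ρ n).normed μ ⋆[lsmul ℝ ℝ, μ] v) y) * φ y) x ∂μ) atTop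
      (𝓝 (∫ x, g x * (Θ (v x) * φ x) ∂μ)) := by
  obtain ⟨C, hC⟩ := exists_abs_le_of_continuous hΘ M
  obtain ⟨B, hB⟩ := hφ.bounded_above_of_compact_support hφc
  have hψc (n : ℕ) :
      Continuous fun y => Θ (((ρ n).normed μ ⋆[lsmul ℝ ℝ, μ] v) y) * φ y :=
    (hΘ.comp (continuous_normed_convolution _ hv.locallyIntegrable)).mul hφ
  have hψb (n : ℕ) (y : E) :
      |Θ (((ρ n).normed μ ⋆[lsmul ℝ ℝ, μ] v) y) * φ y| ≤ C * B := by
    rw [abs_mul]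
    exact mul_le_mul (hC _ (abs_normed_convolution_le _ hM y)) (hB y) (abs_nonneg _)
      ((abs_nonneg _).trans (hC _ (hM y)))
  refine tendsto_integral_of_dominated_convergence (fun x => ‖g x‖ * (C * B)) (fun n => ?_)
    (hg.norm.mul_const _) (fun n => Eventually.of_forall fun x => ?_)
    (Eventually.of_forall fun x => ?_)
  · exact hg.aestronglyMeasurable.mul
      (continuous_normed_convolution _ (hψc n).locallyIntegrable).aestronglyMeasurable
  · rw [norm_mul]
    exact mul_le_mul_of_nonneg_left (abs_normed_convolution_le _ (hψb n) x) (norm_nonneg _)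
  · refine (ContDiffBump.convolution_tendsto_right hρ
      (.of_forall fun n => (hψc n).aestronglyMeasurable) ?_ tendsto_const_nhds).const_mul _
    exact ((hΘ.tendsto _).comp (tendsto_uncurry_normed_convolution hρ hv x)).mul
      ((hφ.tendsto x).comp tendsto_snd)

end ChainRuleForMollifications

section WeakDerivative

variable {N : ℕ} {Ω U V : Opens (EuclideanSpace ℝ (Fin N))} {i : Fin N}
  {u v g : EuclideanSpace ℝ (Fin N) → ℝ}

theorem hasWeakPartialDeriv_iff :
    HasWeakPartialDeriv Ω i u g ↔ ∀ φ : 𝓓(Ω, ℝ),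
      ∫ x, u x * fderiv ℝ φ x (EuclideanSpace.single i (1 : ℝ)) = -∫ x, g x * φ x := by
  refine forall_congr' fun φ => ?_
  rw [setIntegral_eq_integral_of_forall_compl_eq_zero fun x hx => by
      rw [fderiv_testFunction_eq_zero φ hx, zero_apply, mul_zero],
    setIntegral_eq_integral_of_forall_compl_eq_zero fun x hx => by
      rw [testFunction_eq_zero φ hx, mul_zero]]

namespace HasWeakPartialDeriv

theorem mono (h : HasWeakPartialDeriv V i u g) (hUV : U ≤ V) : HasWeakPartialDeriv U i u g :=
  hasWeakPartialDeriv_iff.2 fun φ => hasWeakPartialDeriv_iff.1 h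
    ⟨φ, φ.contDiff, φ.hasCompactSupport, φ.tsupport_subset.trans hUV⟩

theorem congr_ae {u' g' : EuclideanSpace ℝ (Fin N) → ℝ} (h : HasWeakPartialDeriv Ω i u g)
    (hu : u =ᵐ[volume.restrict Ω] u') (hg : g =ᵐ[volume.restrict Ω] g') :
    HasWeakPartialDeriv Ω i u' g' := fun φ =>
  (integral_congr_ae (hu.symm.mul .rfl)).trans
    ((h φ).trans (congrArg Neg.neg (integral_congr_ae (hg.mul .rfl))))

theorem fderiv_convolution (h : HasWeakPartialDeriv ⊤ i v g) (hv : LocallyIntegrable v)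
    {ρ : EuclideanSpace ℝ (Fin N) → ℝ} (hρ : ContDiff ℝ (⊤ : ℕ∞) ρ) (hρc : HasCompactSupport ρ)
    (x : EuclideanSpace ℝ (Fin N)) :
    fderiv ℝ (ρ ⋆[lsmul ℝ ℝ, volume] v) x (EuclideanSpace.single i 1) =
      (ρ ⋆[lsmul ℝ ℝ, volume] g) x := by
  let φ : 𝓓((⊤ : Opens (EuclideanSpace ℝ (Fin N))), ℝ) := ⟨fun t => ρ (x - t),
    hρ.comp (contDiff_const.sub contDiff_id), hρc.comp_homeomorph (Homeomorph.subLeft x),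
    Set.subset_univ _⟩
  have hweak : ∫ t, v t * fderiv ℝ (fun t => ρ (x - t)) t (EuclideanSpace.single i (1 : ℝ)) =
      -∫ t, g t * ρ (x - t) := hasWeakPartialDeriv_iff.1 h φ
  rw [fderiv_convolution_apply_eq_neg_integral (hρ.of_le (by exact_mod_cast le_top)) hρc hv,
    hweak, neg_neg, convolution_eq_swap]
  simp [mul_comm]

theorem comp_of_bounded (h : HasWeakPartialDeriv ⊤ i v g) (hv : Continuous v) {M : ℝ}
    (hM : ∀ x, |v x| ≤ M) (hg : Integrable g) {Ψ : ℝ → ℝ} (hΨ : ContDiff ℝ 1 Ψ) :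
    HasWeakPartialDeriv ⊤ i (fun x => Ψ (v x)) fun x => deriv Ψ (v x) * g x := by
  refine hasWeakPartialDeriv_iff.2 fun φ => ?_
  obtain ⟨ρ, hρ⟩ := exists_contDiffBump_tendsto_rOut (EuclideanSpace ℝ (Fin N))
  have hvl : LocallyIntegrable v := hv.locallyIntegrable
  have hΨ' : Continuous (deriv Ψ) := hΨ.continuous_deriv le_rfl
  have hφ1 : ContDiff ℝ 1 φ := φ.contDiff.of_le (by exact_mod_cast le_top)
  have hmollified (n : ℕ) :
      ∫ x, Ψ (((ρ n).normed volume ⋆[lsmul ℝ ℝ, volume] v) x) *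
          fderiv ℝ φ x (EuclideanSpace.single i (1 : ℝ)) =
        -∫ x, g x * ((ρ n).normed volume ⋆[lsmul ℝ ℝ, volume] fun y =>
          deriv Ψ (((ρ n).normed volume ⋆[lsmul ℝ ℝ, volume] v) y) * φ y) x := by
    have hψ : Integrable fun y =>
        deriv Ψ (((ρ n).normed volume ⋆[lsmul ℝ ℝ, volume] v) y) * φ y :=
      ((hΨ'.comp (continuous_normed_convolution _ hvl)).mul
        φ.continuous).integrable_of_hasCompactSupport φ.hasCompactSupport.mul_left
    rw [integral_comp_mul_fderiv_eq_neg hΨ ((ρ n).hasCompactSupport_normed.contDiff_convolution_left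
      _ (ρ n).contDiff_normed hvl) hφ1 φ.hasCompactSupport,
      ← integral_mul_normed_convolution (ρ n) hψ hg]
    simp only [h.fderiv_convolution hvl (ρ n).contDiff_normed (ρ n).hasCompactSupport_normed]
  have hleft := tendsto_integral_comp_normed_convolution_mul hρ hv hM hΨ.continuous
    ((continuous_fderiv_testFunction_apply φ (EuclideanSpace.single i
      (1 : ℝ))).integrable_of_hasCompactSupport
      (hasCompactSupport_fderiv_testFunction_apply φ _) (μ := volume))
  have hright := (tendsto_integral_mul_normed_convolution_comp_mul hρ hv hM hΨ' φ.continuous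
    φ.hasCompactSupport hg).neg
  simp only [hmollified] at hleft
  rw [tendsto_nhds_unique hleft hright]
  congr! 3
  ring

end HasWeakPartialDeriv

theorem integrable_mul_of_tsupport_subset (hu : LocallyIntegrableOn u Ω)
    {ψ : EuclideanSpace ℝ (Fin N) → ℝ} (hψ : Continuous ψ) (hψc : HasCompactSupport ψ)
    (hψΩ : tsupport ψ ⊆ Ω) : Integrable fun x => ψ x * u x := by
  rw [← integrableOn_iff_integrable_of_support_subset (s := tsupport ψ) fun x hx =>
    subset_tsupport ψ (left_ne_zero_of_mul hx)]
  exact (hu.integrableOn_compact_subset hψΩ hψc).continuousOn_mul hψ.continuousOn hψc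

theorem integrable_testFunction_mul (hu : LocallyIntegrableOn u Ω) (η : 𝓓(Ω, ℝ)) :
    Integrable fun x => η x * u x :=
  integrable_mul_of_tsupport_subset hu η.continuous η.hasCompactSupport η.tsupport_subset

theorem integrable_fderiv_testFunction_mul (hu : LocallyIntegrableOn u Ω) (η : 𝓓(Ω, ℝ))
    (e : EuclideanSpace ℝ (Fin N)) : Integrable fun x => fderiv ℝ η x e * u x :=
  integrable_mul_of_tsupport_subset hu (continuous_fderiv_testFunction_apply η e)
    (hasCompactSupport_fderiv_testFunction_apply η e)
    ((tsupport_fderiv_apply_subset ℝ e).trans η.tsupport_subset)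

theorem HasWeakPartialDeriv.testFunction_mul (h : HasWeakPartialDeriv U i u g)
    (hu : LocallyIntegrableOn u U) (hg : LocallyIntegrableOn g U) (η : 𝓓(U, ℝ)) :
    HasWeakPartialDeriv V i (fun x => η x * u x)
      fun x => η x * g x + fderiv ℝ η x (EuclideanSpace.single i (1 : ℝ)) * u x := by
  refine hasWeakPartialDeriv_iff.2 fun φ => ?_
  set e : EuclideanSpace ℝ (Fin N) := EuclideanSpace.single i (1 : ℝ)
  let ηφ : 𝓓(U, ℝ) := ⟨fun x => η x * φ x, η.contDiff.mul φ.contDiff,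
    η.hasCompactSupport.mul_right, tsupport_mul_subset_left.trans η.tsupport_subset⟩
  have hproduct (x : EuclideanSpace ℝ (Fin N)) :
      fderiv ℝ ηφ x e = η x * fderiv ℝ φ x e + fderiv ℝ η x e * φ x := by
    change fderiv ℝ (fun x => η x * φ x) x e = _
    rw [fderiv_fun_mul (η.contDiff.differentiable (by simp) x)
      (φ.contDiff.differentiable (by simp) x)]
    simp [mul_comm]
  have hDηφ : Integrable fun x => u x * fderiv ℝ ηφ x e := by
    simpa only [mul_comm] using integrable_fderiv_testFunction_mul hu ηφ e
  have hηgφ : Integrable fun x => g x * ηφ x := by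
    simpa only [mul_comm] using integrable_testFunction_mul hg ηφ
  have hDηuφ : Integrable fun x => fderiv ℝ η x e * φ x * u x :=
    integrable_mul_of_tsupport_subset hu
      ((continuous_fderiv_testFunction_apply η e).mul φ.continuous)
      (hasCompactSupport_fderiv_testFunction_apply η e).mul_right
      ((tsupport_mul_subset_left.trans (tsupport_fderiv_apply_subset ℝ e)).trans
        η.tsupport_subset)
  calc ∫ x, η x * u x * fderiv ℝ φ x e
      = ∫ x, (u x * fderiv ℝ ηφ x e - fderiv ℝ η x e * φ x * u x) := by
        congr! 2 with x
        rw [hproduct]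
        ring
    _ = -(∫ x, g x * ηφ x) - ∫ x, fderiv ℝ η x e * φ x * u x := by
        rw [integral_sub hDηφ hDηuφ, hasWeakPartialDeriv_iff.1 h ηφ]
    _ = -∫ x, (η x * g x + fderiv ℝ η x e * u x) * φ x := by
        rw [← neg_add', ← integral_add hηgφ hDηuφ]
        congr! 3 with x
        change g x * (η x * φ x) + _ = _
        ring

theorem continuous_testFunction_mul (hu : ContinuousOn u Ω) (η : 𝓓(Ω, ℝ)) :
    Continuous fun x => η x * u x :=
  continuous_of_tsupport fun _ hx => η.continuous.continuousAt.mul <|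
    hu.continuousAt <| Ω.isOpen.mem_nhds <| η.tsupport_subset <| tsupport_mul_subset_left hx

theorem HasWeakPartialDeriv.comp (h : HasWeakPartialDeriv Ω i u g) (hu : ContinuousOn u Ω)
    (hg : LocallyIntegrableOn g Ω) {Ψ : ℝ → ℝ} (hΨ : ContDiff ℝ 1 Ψ) :
    HasWeakPartialDeriv Ω i (fun x => Ψ (u x)) fun x => deriv Ψ (u x) * g x := by
  refine hasWeakPartialDeriv_iff.2 fun φ => ?_
  obtain ⟨η, hη⟩ := exists_testFunction_eventuallyEq_one φ.hasCompactSupport φ.tsupport_subset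
  have hul : LocallyIntegrableOn u Ω := hu.locallyIntegrableOn Ω.isOpen.measurableSet
  have hηu := continuous_testFunction_mul hu η
  obtain ⟨M, hM⟩ := hηu.bounded_above_of_compact_support η.hasCompactSupport.mul_right
  have hloc := hasWeakPartialDeriv_iff.1 ((h.testFunction_mul hul hg η).comp_of_bounded hηu hM
    ((integrable_testFunction_mul hg η).add (integrable_fderiv_testFunction_mul hul η _)) hΨ)
    ⟨φ, φ.contDiff, φ.hasCompactSupport, Set.subset_univ _⟩
  have hη_near {x : EuclideanSpace ℝ (Fin N)} (hx : x ∈ tsupport φ) : η =ᶠ[𝓝 x] 1 :=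
    hη.filter_mono (nhds_le_nhdsSet hx)
  have hη_one {x : EuclideanSpace ℝ (Fin N)} (hx : x ∈ tsupport φ) : η x = 1 :=
    (hη_near hx).self_of_nhds
  have hη_fderiv {x : EuclideanSpace ℝ (Fin N)} (hx : x ∈ tsupport φ) : fderiv ℝ η x = 0 := by
    rw [(hη_near hx).fderiv_eq, fderiv_one]
    rfl
  convert hloc using 3 with x
  · by_cases hx : x ∈ tsupport φ
    · simp [hη_one hx]
    · simp [image_eq_zero_of_notMem_tsupport fun h => hx (tsupport_fderiv_subset ℝ h)]
  · funext x
    by_cases hx : x ∈ tsupport φ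
    · simp [hη_one hx, hη_fderiv hx]
    · simp [image_eq_zero_of_notMem_tsupport hx]

end WeakDerivative

section LpOperator

variable {α : Type*} [MeasurableSpace α] {μ ν : Measure α} {p : ℝ≥0∞} {ψ : α → ℝ} {M : ℝ}

theorem eLpNorm_mul_le_of_restrict_support_le (hψ : Measurable ψ) (hM : ∀ x, |ψ x| ≤ M)
    (hνμ : ν.restrict (Function.support ψ) ≤ μ) (p : ℝ≥0∞) (f : α → ℝ) :
    eLpNorm (fun x => ψ x * f x) p ν ≤ ENNReal.ofReal M * eLpNorm f p μ := by
  have hsupp : (Function.support ψ).indicator (fun x => ψ x * f x) = fun x => ψ x * f x :=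
    Set.indicator_eq_self.2 (Function.support_mul_subset_left ψ f)
  rw [← hsupp, eLpNorm_indicator_eq_eLpNorm_restrict (measurableSet_support hψ)]
  calc eLpNorm (fun x => ψ x * f x) p (ν.restrict (Function.support ψ))
      ≤ eLpNorm (fun x => ψ x * f x) p μ := eLpNorm_mono_measure _ hνμ
    _ ≤ ENNReal.ofReal M * eLpNorm f p μ := by
      refine eLpNorm_le_mul_eLpNorm_of_ae_le_mul (Eventually.of_forall fun x => ?_) p
      rw [norm_mul]
      exact mul_le_mul_of_nonneg_right (hM x) (norm_nonneg _)

theorem mul_ae_eq_mul_of_restrict_support_le (hψ : Measurable ψ)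
    (hνμ : ν.restrict (Function.support ψ) ≤ μ) {f g : α → ℝ} (hfg : f =ᵐ[μ] g) :
    (fun x => ψ x * f x) =ᵐ[ν] fun x => ψ x * g x := by
  filter_upwards [(ae_restrict_iff' (measurableSet_support hψ)).1 (ae_mono hνμ hfg)] with x hx
  by_cases hx0 : ψ x = 0
  · rw [hx0, zero_mul, zero_mul]
  · rw [hx hx0]

theorem memLp_mul_of_restrict_support_le (hψ : Measurable ψ) (hM : ∃ M, ∀ x, |ψ x| ≤ M)
    (hνμ : ν.restrict (Function.support ψ) ≤ μ) (f : Lp ℝ p μ) :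
    MemLp (fun x => ψ x * f x) p ν := by
  obtain ⟨M, hM⟩ := hM
  exact ⟨hψ.aestronglyMeasurable.mul (Lp.stronglyMeasurable f).aestronglyMeasurable,
    (eLpNorm_mul_le_of_restrict_support_le hψ hM hνμ p f).trans_lt
      (ENNReal.mul_lt_top ENNReal.ofReal_lt_top (Lp.eLpNorm_lt_top f))⟩

theorem norm_toLp_mul_le (hψ : Measurable ψ) (hM : ∀ x, |ψ x| ≤ M) (hM0 : 0 ≤ M)
    (hνμ : ν.restrict (Function.support ψ) ≤ μ) (f : Lp ℝ p μ) :
    ‖(memLp_mul_of_restrict_support_le hψ ⟨M, hM⟩ hνμ f).toLp‖ ≤ M * ‖f‖ := by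
  rw [Lp.norm_toLp, Lp.norm_def, ← ENNReal.toReal_ofReal hM0, ← ENNReal.toReal_mul]
  exact ENNReal.toReal_mono (ENNReal.mul_ne_top ENNReal.ofReal_ne_top (Lp.eLpNorm_ne_top f))
    (eLpNorm_mul_le_of_restrict_support_le hψ hM hνμ p f)

variable [Fact (1 ≤ p)]

/-- Multiplication by a bounded function `ψ` as an operator from `L^p(μ)` to `L^p(ν)`, where the
products are extended by zero off the support of `ψ`. -/
def lpMul (hψ : Measurable ψ) (hM : ∃ M, ∀ x, |ψ x| ≤ M)
    (hνμ : ν.restrict (Function.support ψ) ≤ μ) : Lp ℝ p μ →L[ℝ] Lp ℝ p ν :=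
  LinearMap.mkContinuousOfExistsBound
    { toFun := fun f => (memLp_mul_of_restrict_support_le hψ hM hνμ f).toLp
      map_add' := fun f g => by
        rw [← MemLp.toLp_add]
        refine MemLp.toLp_congr _ _ ?_
        refine (mul_ae_eq_mul_of_restrict_support_le hψ hνμ (Lp.coeFn_add f g)).trans ?_
        exact Eventually.of_forall fun x => mul_add _ _ _
      map_smul' := fun c f => by
        rw [RingHom.id_apply, ← MemLp.toLp_const_smul]
        refine MemLp.toLp_congr _ _ ?_
        refine (mul_ae_eq_mul_of_restrict_support_le hψ hνμ (Lp.coeFn_smul c f)).trans ?_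
        exact Eventually.of_forall fun x => mul_left_comm _ _ _ }
    (by
      obtain ⟨M, hM⟩ := hM
      exact ⟨|M|, norm_toLp_mul_le hψ (fun x => (hM x).trans (le_abs_self M)) (abs_nonneg M) hνμ⟩)

theorem coeFn_lpMul (hψ : Measurable ψ) (hM : ∃ M, ∀ x, |ψ x| ≤ M)
    (hνμ : ν.restrict (Function.support ψ) ≤ μ) (f : Lp ℝ p μ) :
    lpMul hψ hM hνμ f =ᵐ[ν] fun x => ψ x * f x :=
  (memLp_mul_of_restrict_support_le hψ hM hνμ f).coeFn_toLp

theorem norm_lpMul_le (hψ : Measurable ψ) (hM : ∀ x, |ψ x| ≤ M) (hM0 : 0 ≤ M)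
    (hνμ : ν.restrict (Function.support ψ) ≤ μ) (f : Lp ℝ p μ) :
    ‖lpMul hψ ⟨M, hM⟩ hνμ f‖ ≤ M * ‖f‖ :=
  norm_toLp_mul_le hψ hM hM0 hνμ f

theorem ae_abs_sub_le_of_tendsto {f h : ℕ → Lp ℝ p μ} {F H : Lp ℝ p μ} {r : ℝ}
    (hf : Tendsto f atTop (𝓝 F)) (hh : Tendsto h atTop (𝓝 H))
    (hfh : ∀ n, ∀ᵐ x ∂μ, |f n x| - r ≤ h n x) : ∀ᵐ x ∂μ, |F x| - r ≤ H x := by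
  obtain ⟨ns, hns, hf_ae⟩ := (tendstoInMeasure_of_tendsto_Lp hf).exists_seq_tendsto_ae
  obtain ⟨ms, hms, hh_ae⟩ := (tendstoInMeasure_of_tendsto_Lp
    (hh.comp hns.tendsto_atTop)).exists_seq_tendsto_ae
  filter_upwards [hf_ae, hh_ae, ae_all_iff.2 hfh] with x hfx hhx hfhx
  exact le_of_tendsto_of_tendsto' ((hfx.comp hms.tendsto_atTop).abs.sub_const r) hhx
    fun n => hfhx _

theorem ae_abs_sub_le_of_hasSum {f h : ℕ → Lp ℝ p μ} {F H : Lp ℝ p μ} {δ : ℕ → ℝ} {r : ℝ}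
    (hf : HasSum f F) (hh : HasSum h H) (hδ0 : ∀ n, 0 ≤ δ n) (hδ : HasSum δ r)
    (hfh : ∀ n, ∀ᵐ x ∂μ, |f n x| - δ n ≤ h n x) : ∀ᵐ x ∂μ, |F x| - r ≤ H x := by
  refine ae_abs_sub_le_of_tendsto hf.tendsto_sum_nat hh.tendsto_sum_nat fun n => ?_
  filter_upwards [ae_all_iff.2 hfh, Lp.coeFn_fun_finsetSum (Finset.range n) f,
    Lp.coeFn_fun_finsetSum (Finset.range n) h] with x hx hfx hhx
  rw [hfx, hhx]
  calc |∑ k ∈ Finset.range n, f k x| - r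
      ≤ ∑ k ∈ Finset.range n, |f k x| - ∑ k ∈ Finset.range n, δ k :=
        sub_le_sub (Finset.abs_sum_le_sum_abs _ _) (sum_le_hasSum _ (fun k _ => hδ0 k) hδ)
    _ = ∑ k ∈ Finset.range n, (|f k x| - δ k) := (Finset.sum_sub_distrib _ _).symm
    _ ≤ ∑ k ∈ Finset.range n, h k x := Finset.sum_le_sum fun k _ => hx k

/-- Integration against a continuous function with compact support, as a functional on `L^p`. -/
def lpIntegralMul {E : Type*} [TopologicalSpace E] [R1Space E] [MeasurableSpace E]
    [OpensMeasurableSpace E] [SecondCountableTopology E] (p : ℝ≥0∞) [Fact (1 ≤ p)]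
    (μ : Measure E) [IsFiniteMeasureOnCompacts μ] {ψ : E → ℝ} (hψ : Continuous ψ)
    (hψc : HasCompactSupport ψ) : Lp ℝ p μ →L[ℝ] ℝ :=
  have : ENNReal.HolderConjugate p (1 - p⁻¹)⁻¹ := .inv_one_sub_inv' Fact.out
  have : Fact (1 ≤ (1 - p⁻¹)⁻¹) := ⟨ENNReal.HolderConjugate.one_le (1 - p⁻¹)⁻¹ p⟩
  ((ContinuousLinearMap.mul ℝ ℝ).lpPairing μ p (1 - p⁻¹)⁻¹).flip
    (hψ.memLp_of_hasCompactSupport hψc).toLp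

theorem lpIntegralMul_apply {E : Type*} [TopologicalSpace E] [R1Space E] [MeasurableSpace E]
    [OpensMeasurableSpace E] [SecondCountableTopology E] {μ : Measure E}
    [IsFiniteMeasureOnCompacts μ] {ψ : E → ℝ} (hψ : Continuous ψ) (hψc : HasCompactSupport ψ)
    (f : Lp ℝ p μ) : lpIntegralMul p μ hψ hψc f = ∫ x, f x * ψ x ∂μ := by
  have : ENNReal.HolderConjugate p (1 - p⁻¹)⁻¹ := .inv_one_sub_inv' Fact.out
  have : Fact (1 ≤ (1 - p⁻¹)⁻¹) := ⟨ENNReal.HolderConjugate.one_le (1 - p⁻¹)⁻¹ p⟩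
  rw [lpIntegralMul, ContinuousLinearMap.flip_apply, ContinuousLinearMap.lpPairing_eq_integral]
  refine integral_congr_ae ?_
  filter_upwards [(hψ.memLp_of_hasCompactSupport hψc).coeFn_toLp] with x hx
  rw [hx, mul_apply']

end LpOperator

section NormedSpaceLemmas

theorem norm_piLp_le_mul_of_forall {ι : Type*} [Fintype ι] {p : ℝ≥0∞} [Fact (1 ≤ p)]
    {α β : ι → Type*} [∀ j, NormedAddCommGroup (α j)] [∀ j, NormedAddCommGroup (β j)]
    {f : PiLp p α} {g : PiLp p β} {c : ℝ} (hc : 0 ≤ c) (h : ∀ j, ‖f j‖ ≤ c * ‖g j‖) :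
    ‖f‖ ≤ c * ‖g‖ := by
  rcases eq_or_ne p ∞ with rfl | hp
  · rw [PiLp.norm_eq_ciSup, PiLp.norm_eq_ciSup, Real.mul_iSup_of_nonneg hc]
    exact ciSup_mono (Set.finite_range _).bddAbove h
  · have hp0 : 0 < p.toReal := ENNReal.toReal_pos (zero_lt_one.trans_le Fact.out).ne' hp
    rw [PiLp.norm_eq_sum hp0, PiLp.norm_eq_sum hp0]
    calc (∑ j, ‖f j‖ ^ p.toReal) ^ (1 / p.toReal)
        ≤ (∑ j, (c * ‖g j‖) ^ p.toReal) ^ (1 / p.toReal) := by gcongr with j; exact h j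
      _ = (c ^ p.toReal * ∑ j, ‖g j‖ ^ p.toReal) ^ (1 / p.toReal) := by
        simp only [Real.mul_rpow hc (norm_nonneg _), Finset.mul_sum]
      _ = c * (∑ j, ‖g j‖ ^ p.toReal) ^ (1 / p.toReal) := by
        rw [Real.mul_rpow (by positivity) (by positivity), ← Real.rpow_mul hc,
          mul_one_div_cancel hp0.ne', Real.rpow_one]

theorem exists_hasSum_of_mem_closure {E : Type*} [NormedAddCommGroup E] {S : AddSubgroup E}
    {w : E} (hw : w ∈ closure (S : Set E)) {r : ℝ} (hr : 0 < r) :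
    ∃ v : ℕ → E, (∀ n, v n ∈ S) ∧ Summable (fun n => ‖v n‖) ∧ ∑' n, ‖v n‖ ≤ ‖w‖ + r ∧
      HasSum v w := by
  obtain ⟨v, hlim, hmem, hv0, hv⟩ := controlled_sum_of_mem_closure hw
    (b := fun n => r / 2 / 2 ^ n) (fun n => by positivity)
  have hbound (n : ℕ) : ‖v n‖ ≤ (if n = 0 then ‖w‖ else 0) + r / 2 / 2 ^ n := by
    rcases n.eq_zero_or_pos with rfl | hn
    · rw [if_pos rfl]
      exact (norm_le_norm_add_norm_neg_add (v 0) w).trans (add_le_add_right hv0.le _)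
    · rw [if_neg hn.ne', zero_add]
      exact (hv n hn).le
  have hsum := (hasSum_ite_eq 0 ‖w‖).add (hasSum_geometric_two' r)
  have hv_summable : Summable fun n => ‖v n‖ :=
    .of_nonneg_of_le (fun n => norm_nonneg _) hbound hsum.summable
  exact ⟨v, hmem, hv_summable, hasSum_le hbound hv_summable.hasSum hsum,
    hasSum_of_subseq_of_summable hv_summable
      (tendsto_finset_range.comp (tendsto_add_atTop_nat 1)) hlim⟩

end NormedSpaceLemmas

section Jet

variable {N : ℕ} {p : ℝ≥0∞} {Ω : Opens (EuclideanSpace ℝ (Fin N))}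
  {w : LpJet p Ω}

theorem exists_continuousOn_ae_eq_of_mem_sobolevCc (hw : w ∈ sobolevCc p Ω) :
    ∃ F : EuclideanSpace ℝ (Fin N) → ℝ, ContinuousOn F Ω ∧ w none =ᵐ[volume.restrict Ω] F := by
  obtain ⟨-, f, hf⟩ := hw
  have hext (x) (hx : x ∈ closure (Ω : Set (EuclideanSpace ℝ (Fin N)))) :
      Function.extend Subtype.val f 0 x = f ⟨x, hx⟩ :=
    Subtype.val_injective.extend_apply f 0 ⟨x, hx⟩
  refine ⟨Function.extend Subtype.val f 0, ContinuousOn.mono ?_ subset_closure, ?_⟩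
  · rw [continuousOn_iff_continuous_domRestrict]
    exact f.continuous.congr fun x => (hext x x.2).symm
  · filter_upwards [hf, ae_restrict_mem Ω.isOpen.measurableSet] with x hx hxΩ
    rw [hx (subset_closure hxΩ), hext]

theorem mem_sobolevCc_of_continuous {F : EuclideanSpace ℝ (Fin N) → ℝ} (hw : w ∈ sobolev p Ω)
    (hF : Continuous F) (hFc : HasCompactSupport F) (hwF : w none =ᵐ[volume.restrict Ω] F) :
    w ∈ sobolevCc p Ω :=
  ⟨hw, ⟨⟨fun x => F x, hF.comp continuous_subtype_val⟩,
    hFc.comp_isClosedEmbedding isClosed_closure.isClosedEmbedding_subtypeVal⟩,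
    hwF.mono fun _ hx _ => hx⟩

variable [Fact (1 ≤ p)]

theorem locallyIntegrableOn_lp (f : Lp ℝ p (volume.restrict (Ω : Set (EuclideanSpace ℝ (Fin N))))) :
    LocallyIntegrableOn f Ω :=
  locallyIntegrableOn_of_locallyIntegrable_restrict ((Lp.memLp f).locallyIntegrable Fact.out)

/-- The continuous functional on `L^p(Ω)^{N+1}` whose vanishing for every test function `φ` says
that the component `some i` is the weak `i`-th partial derivative of the component `none`. -/
def weakDerivDefect (i : Fin N) (φ : 𝓓(Ω, ℝ)) : LpJet p Ω →L[ℝ] ℝ :=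
  lpIntegralMul p _ (continuous_fderiv_testFunction_apply φ (EuclideanSpace.single i (1 : ℝ)))
      (hasCompactSupport_fderiv_testFunction_apply φ _) ∘L PiLp.proj p _ none +
    lpIntegralMul p _ φ.continuous φ.hasCompactSupport ∘L PiLp.proj p _ (some i)

theorem mem_sobolev_iff : w ∈ sobolev p Ω ↔ ∀ i (φ : 𝓓(Ω, ℝ)), weakDerivDefect i φ w = 0 := by
  simp only [sobolev, HasWeakPartialDeriv, Set.mem_ofPred_eq, weakDerivDefect, add_apply,
    comp_apply, PiLp.proj_apply, lpIntegralMul_apply, add_eq_zero_iff_eq_neg]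

theorem isClosed_sobolev : IsClosed (sobolev p Ω) := by
  have hker : sobolev p Ω = ⋂ (i : Fin N) (φ : 𝓓(Ω, ℝ)), {w | weakDerivDefect i φ w = 0} := by
    ext w
    simp only [mem_sobolev_iff, Set.mem_iInter, Set.mem_ofPred_eq]
  rw [hker]
  exact isClosed_iInter fun i => isClosed_iInter fun φ =>
    isClosed_eq (weakDerivDefect i φ).continuous continuous_const

theorem sobolevTilde_eq_closure : sobolevTilde p Ω = closure (sobolevCc p Ω) :=
  Set.inter_eq_self_of_subset_right <| closure_minimal (fun _ hw => hw.1) isClosed_sobolev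

/-- The set `sobolevCc p Ω` as a linear subspace of `L^p(Ω)^{N+1}`. -/
def sobolevCcSubmodule (p : ℝ≥0∞) [Fact (1 ≤ p)] (Ω : Opens (EuclideanSpace ℝ (Fin N))) :
    Submodule ℝ (LpJet p Ω) where
  carrier := sobolevCc p Ω
  add_mem' := by
    rintro w w' ⟨hw, f, hf⟩ ⟨hw', f', hf'⟩
    refine ⟨mem_sobolev_iff.2 fun i φ => ?_, f + f', ?_⟩
    · rw [map_add, mem_sobolev_iff.1 hw, mem_sobolev_iff.1 hw', add_zero]
    · filter_upwards [hf, hf', Lp.coeFn_add (w none) (w' none)] with x hfx hfx' hx hxΩ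
      rw [PiLp.add_apply, hx, Pi.add_apply, hfx hxΩ, hfx' hxΩ]
      rfl
  zero_mem' := by
    refine ⟨mem_sobolev_iff.2 fun i φ => map_zero _, 0, ?_⟩
    filter_upwards [Lp.coeFn_zero ℝ p (volume.restrict (Ω : Set (EuclideanSpace ℝ (Fin N))))]
      with x hx _
    exact hx
  smul_mem' := by
    rintro c w ⟨hw, f, hf⟩
    refine ⟨mem_sobolev_iff.2 fun i φ => ?_, c • f, ?_⟩
    · rw [map_smul, mem_sobolev_iff.1 hw, smul_zero]
    · filter_upwards [hf, Lp.coeFn_smul c (w none)] with x hfx hx hxΩ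
      rw [PiLp.smul_apply, hx, Pi.smul_apply, hfx hxΩ]
      rfl

theorem coe_topologicalClosure_sobolevCcSubmodule :
    ((sobolevCcSubmodule p Ω).topologicalClosure : Set (LpJet p Ω)) = sobolevTilde p Ω :=
  sobolevTilde_eq_closure.symm

theorem sobolevCc_subset_sobolevTilde : sobolevCc p Ω ⊆ sobolevTilde p Ω := by
  rw [sobolevTilde_eq_closure]
  exact subset_closure

theorem smul_mem_sobolevTilde (c : ℝ) (hw : w ∈ sobolevTilde p Ω) : c • w ∈ sobolevTilde p Ω := by
  rw [← coe_topologicalClosure_sobolevCcSubmodule] at hw ⊢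
  exact Submodule.smul_mem _ c hw

theorem hasSum_mem_sobolevTilde {f : ℕ → LpJet p Ω} (hf : HasSum f w)
    (hmem : ∀ n, f n ∈ sobolevTilde p Ω) : w ∈ sobolevTilde p Ω := by
  rw [← coe_topologicalClosure_sobolevCcSubmodule] at hmem ⊢
  exact (Submodule.isClosed_topologicalClosure _).mem_of_tendsto hf <|
    .of_forall fun _ => Submodule.sum_mem _ fun n _ => hmem n

theorem hasSum_jet_apply {f : ℕ → LpJet p Ω} (hf : HasSum f w) (j : Option (Fin N)) :
    HasSum (fun n => f n j) (w j) := (PiLp.proj p _ j : LpJet p Ω →L[ℝ] _).hasSum hf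

end Jet

section JetOperator

/-- The operator into a `PiLp` space with the components `T j`. -/
def piLpOfComponents {ι E : Type*} [Fintype ι] [NormedAddCommGroup E] [NormedSpace ℝ E]
    {p : ℝ≥0∞} [Fact (1 ≤ p)] {β : ι → Type*} [∀ j, NormedAddCommGroup (β j)]
    [∀ j, NormedSpace ℝ (β j)] (T : ∀ j, E →L[ℝ] β j) : E →L[ℝ] PiLp p β :=
  (PiLp.continuousLinearEquiv p ℝ β).symm.toContinuousLinearMap ∘L ContinuousLinearMap.pi T

variable {N : ℕ} {p : ℝ≥0∞} [Fact (1 ≤ p)] {U V : Opens (EuclideanSpace ℝ (Fin N))}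

/-- The inclusion of `L^p(μ)` in `L^p(ν)` for `ν ≤ μ`. -/
def lpOfMeasureLE {α : Type*} [MeasurableSpace α] {μ ν : Measure α} (hνμ : ν ≤ μ) :
    Lp ℝ p μ →L[ℝ] Lp ℝ p ν :=
  lpMul (ψ := 1) measurable_one ⟨1, fun _ => abs_one.le⟩ (Measure.restrict_le_self.trans hνμ)

theorem coeFn_lpOfMeasureLE {α : Type*} [MeasurableSpace α] {μ ν : Measure α} (hνμ : ν ≤ μ)
    (f : Lp ℝ p μ) : lpOfMeasureLE hνμ f =ᵐ[ν] f := by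
  unfold lpOfMeasureLE
  exact (coeFn_lpMul _ _ _ f).trans (.of_forall fun x => one_mul (f x))

theorem norm_lpOfMeasureLE_le {α : Type*} [MeasurableSpace α] {μ ν : Measure α} (hνμ : ν ≤ μ)
    (f : Lp ℝ p μ) : ‖lpOfMeasureLE hνμ f‖ ≤ ‖f‖ := by
  unfold lpOfMeasureLE
  exact (norm_lpMul_le _ (fun _ => abs_one.le) zero_le_one _ f).trans_eq (one_mul _)

/-- The restriction operator from `L^p(V)^{N+1}` to `L^p(U)^{N+1}` for `U ⊆ V`. -/
def jetRestrict (hUV : U ≤ V) : LpJet p V →L[ℝ] LpJet p U :=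
  piLpOfComponents fun j => lpOfMeasureLE (Measure.restrict_mono hUV le_rfl) ∘L PiLp.proj p _ j

theorem jetRestrict_apply_ae_eq (hUV : U ≤ V) (w : LpJet p V) (j : Option (Fin N)) :
    jetRestrict hUV w j =ᵐ[volume.restrict U] w j :=
  coeFn_lpOfMeasureLE (Measure.restrict_mono hUV le_rfl) (w j)

theorem norm_jetRestrict_le (hUV : U ≤ V) (w : LpJet p V) : ‖jetRestrict hUV w‖ ≤ ‖w‖ := by
  rw [← one_mul ‖w‖]
  refine norm_piLp_le_mul_of_forall zero_le_one fun j => ?_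
  rw [one_mul]
  exact norm_lpOfMeasureLE_le (Measure.restrict_mono hUV le_rfl) (w j)

theorem jetRestrict_mem_sobolevCc (hUV : U ≤ V) {w : LpJet p V} (hw : w ∈ sobolevCc p V) :
    jetRestrict hUV w ∈ sobolevCc p U := by
  obtain ⟨hw, f, hf⟩ := hw
  have hcl := closure_mono (show (U : Set (EuclideanSpace ℝ (Fin N))) ⊆ V from hUV)
  have hemb : IsClosedEmbedding (Set.inclusion hcl) :=
    ⟨.inclusion hcl, by
      rw [Set.range_inclusion]
      exact isClosed_closure.preimage continuous_subtype_val⟩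
  refine ⟨fun i => ((hw i).mono hUV).congr_ae (jetRestrict_apply_ae_eq hUV w none).symm
    (jetRestrict_apply_ae_eq hUV w (some i)).symm,
    ⟨⟨f ∘ Set.inclusion hcl, f.continuous.comp hemb.continuous⟩,
      f.hasCompactSupport.comp_isClosedEmbedding hemb⟩, ?_⟩
  filter_upwards [ae_restrict_of_ae_restrict_of_subset hUV hf, jetRestrict_apply_ae_eq hUV w none]
    with x hfx hwx hx
  rw [hwx, hfx (hcl hx)]
  rfl

theorem jetRestrict_mem_sobolevTilde (hUV : U ≤ V) {w : LpJet p V} (hw : w ∈ sobolevTilde p V) :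
    jetRestrict hUV w ∈ sobolevTilde p U := by
  rw [sobolevTilde_eq_closure] at hw ⊢
  exact map_mem_closure (jetRestrict hUV).continuous hw fun _ => jetRestrict_mem_sobolevCc hUV

/-- Multiplication by a continuous function `ψ` with compact support in `U`, as an operator from
`L^p(U)` to `L^p(V)`. -/
def lpMulCompactSupport (V : Opens (EuclideanSpace ℝ (Fin N))) {ψ : EuclideanSpace ℝ (Fin N) → ℝ}
    (hψ : Continuous ψ) (hψc : HasCompactSupport ψ) (hψU : tsupport ψ ⊆ U) :
    Lp ℝ p (volume.restrict (U : Set (EuclideanSpace ℝ (Fin N)))) →L[ℝ]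
      Lp ℝ p (volume.restrict (V : Set (EuclideanSpace ℝ (Fin N)))) :=
  lpMul hψ.measurable (hψc.exists_bound_of_continuous hψ) <|
    (Measure.restrict_mono_measure Measure.restrict_le_self _).trans <|
      Measure.restrict_mono ((subset_tsupport ψ).trans hψU) le_rfl

theorem coeFn_lpMulCompactSupport {ψ : EuclideanSpace ℝ (Fin N) → ℝ} (hψ : Continuous ψ)
    (hψc : HasCompactSupport ψ) (hψU : tsupport ψ ⊆ U)
    (f : Lp ℝ p (volume.restrict (U : Set (EuclideanSpace ℝ (Fin N))))) :
    lpMulCompactSupport V hψ hψc hψU f =ᵐ[volume.restrict V] fun x => ψ x * f x := by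
  unfold lpMulCompactSupport
  exact coeFn_lpMul _ _ _ f

/-- The product rule: `jetMul V η` sends `(u, ∂₁u, …, ∂_N u)` on `U` to
`(ηu, ∂₁(ηu), …, ∂_N(ηu))` on `V`, for a test function `η` on `U`. -/
def jetMul (V : Opens (EuclideanSpace ℝ (Fin N))) (η : 𝓓(U, ℝ)) : LpJet p U →L[ℝ] LpJet p V :=
  let mul := lpMulCompactSupport V η.continuous η.hasCompactSupport η.tsupport_subset
  piLpOfComponents fun j => j.elim
    (mul ∘L PiLp.proj p _ none)
    fun i => mul ∘L PiLp.proj p _ (some i) +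
      lpMulCompactSupport V
          (continuous_fderiv_testFunction_apply η (EuclideanSpace.single i (1 : ℝ)))
          (hasCompactSupport_fderiv_testFunction_apply η _)
          ((tsupport_fderiv_apply_subset ℝ _).trans η.tsupport_subset) ∘L PiLp.proj p _ none

theorem jetMul_none_ae_eq (η : 𝓓(U, ℝ)) (w : LpJet p U) :
    jetMul V η w none =ᵐ[volume.restrict V] fun x => η x * w none x :=
  coeFn_lpMulCompactSupport η.continuous η.hasCompactSupport η.tsupport_subset (w none)

theorem jetMul_some_ae_eq (η : 𝓓(U, ℝ)) (w : LpJet p U) (i : Fin N) :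
    jetMul V η w (some i) =ᵐ[volume.restrict V] fun x =>
      η x * w (some i) x + fderiv ℝ η x (EuclideanSpace.single i (1 : ℝ)) * w none x :=
  (Lp.coeFn_add _ _).trans <|
    (coeFn_lpMulCompactSupport η.continuous η.hasCompactSupport η.tsupport_subset _).add
      (coeFn_lpMulCompactSupport (continuous_fderiv_testFunction_apply η _)
        (hasCompactSupport_fderiv_testFunction_apply η _)
        ((tsupport_fderiv_apply_subset ℝ _).trans η.tsupport_subset) (w none))

theorem jetMul_mem_sobolevCc (η : 𝓓(U, ℝ)) {w : LpJet p U} (hw : w ∈ sobolevCc p U) :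
    jetMul V η w ∈ sobolevCc p V := by
  obtain ⟨F, hF, hwF⟩ := exists_continuousOn_ae_eq_of_mem_sobolevCc hw
  refine mem_sobolevCc_of_continuous (F := fun x => η x * F x) (fun i => ?_)
    (continuous_testFunction_mul hF η) η.hasCompactSupport.mul_right ?_
  · exact ((hw.1 i).testFunction_mul (locallyIntegrableOn_lp _) (locallyIntegrableOn_lp _)
      η).congr_ae (jetMul_none_ae_eq η w).symm (jetMul_some_ae_eq η w i).symm
  · refine (jetMul_none_ae_eq η w).trans (ae_restrict_of_ae ?_)
    filter_upwards [(ae_restrict_iff' U.isOpen.measurableSet).1 hwF] with x hx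
    by_cases hxU : x ∈ U
    · rw [hx hxU]
    · rw [testFunction_eq_zero η hxU, zero_mul, zero_mul]

theorem jetMul_mem_sobolevTilde (η : 𝓓(U, ℝ)) {w : LpJet p U} (hw : w ∈ sobolevTilde p U) :
    jetMul V η w ∈ sobolevTilde p V := by
  rw [sobolevTilde_eq_closure] at hw ⊢
  exact map_mem_closure (jetMul V η).continuous hw fun _ => jetMul_mem_sobolevCc η

end JetOperator

section SoftAbs

variable {δ : ℝ}

/-- The smooth approximation `√(t² + δ²) - δ` of `|t|`. Unlike `|t|` it is `C¹`, so that the chain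
rule applies, and it is still nonnegative, at most `|t|` and `1`-Lipschitz. -/
def softAbs (δ t : ℝ) : ℝ := √(t ^ 2 + δ ^ 2) - δ

theorem contDiff_softAbs (hδ : 0 < δ) : ContDiff ℝ 1 (softAbs δ) := by
  refine ContDiff.sub (ContDiff.sqrt (by fun_prop) fun t => ?_) contDiff_const
  positivity

theorem softAbs_nonneg (δ t : ℝ) : 0 ≤ softAbs δ t :=
  sub_nonneg.2 <| Real.le_sqrt_of_sq_le <| le_add_of_nonneg_left <| sq_nonneg t

theorem abs_softAbs_le (hδ : 0 < δ) (t : ℝ) : |softAbs δ t| ≤ |t| := by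
  rw [abs_of_nonneg (softAbs_nonneg δ t), softAbs, sub_le_iff_le_add]
  refine Real.sqrt_le_iff.2 ⟨by positivity, ?_⟩
  nlinarith [sq_abs t, abs_nonneg t]

theorem softAbs_zero (hδ : 0 < δ) : softAbs δ 0 = 0 :=
  abs_nonpos_iff.1 ((abs_softAbs_le hδ 0).trans_eq abs_zero)

theorem abs_sub_le_softAbs (δ t : ℝ) : |t| - δ ≤ softAbs δ t :=
  sub_le_sub_right (Real.abs_le_sqrt (le_add_of_nonneg_right (sq_nonneg δ))) δ

theorem abs_deriv_softAbs_le (hδ : 0 < δ) (t : ℝ) : |deriv (softAbs δ) t| ≤ 1 := by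
  have hpos : 0 < t ^ 2 + δ ^ 2 := by positivity
  have hderiv : HasDerivAt (softAbs δ) (2 * t / (2 * √(t ^ 2 + δ ^ 2))) t := by
    have hsq : HasDerivAt (fun s : ℝ => s ^ 2 + δ ^ 2) (2 * t) t := by
      simpa using (hasDerivAt_pow 2 t).add_const (δ ^ 2)
    exact (hsq.sqrt hpos.ne').sub_const δ
  rw [hderiv.deriv, mul_div_mul_left _ _ two_ne_zero, abs_div,
    abs_of_pos (Real.sqrt_pos.2 hpos)]
  exact div_le_one_of_le₀ (Real.abs_le_sqrt (le_add_of_nonneg_right (sq_nonneg δ)))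
    (Real.sqrt_nonneg _)

end SoftAbs

section Truncation

variable {N : ℕ} {p : ℝ≥0∞} [Fact (1 ≤ p)] {Ω : Opens (EuclideanSpace ℝ (Fin N))}

theorem exists_jet_ae_eq (w : LpJet p Ω) {F : Option (Fin N) → EuclideanSpace ℝ (Fin N) → ℝ}
    (hF : ∀ j, AEStronglyMeasurable (F j) (volume.restrict Ω))
    (hFw : ∀ j, ∀ᵐ x ∂volume.restrict Ω, |F j x| ≤ |w j x|) :
    ∃ w' : LpJet p Ω, (∀ j, w' j =ᵐ[volume.restrict Ω] F j) ∧ ‖w'‖ ≤ ‖w‖ := by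
  have hF_memLp (j) : MemLp (F j) p (volume.restrict Ω) := (Lp.memLp (w j)).mono (hF j) (hFw j)
  refine ⟨WithLp.toLp p fun j => (hF_memLp j).toLp, fun j => (hF_memLp j).coeFn_toLp, ?_⟩
  rw [← one_mul ‖w‖]
  refine norm_piLp_le_mul_of_forall zero_le_one fun j => ?_
  rw [one_mul]
  refine Lp.norm_le_norm_of_ae_le ?_
  filter_upwards [(hF_memLp j).coeFn_toLp, hFw j] with x hx hFwx
  rw [hx]
  exact hFwx

theorem hasWeakPartialDeriv_comp_of_mem_sobolevCc {w : LpJet p Ω} (hw : w ∈ sobolevCc p Ω)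
    {Ψ : ℝ → ℝ} (hΨ : ContDiff ℝ 1 Ψ) (i : Fin N) :
    HasWeakPartialDeriv Ω i (fun x => Ψ (w none x))
      fun x => deriv Ψ (w none x) * w (some i) x := by
  obtain ⟨F, hF, hwF⟩ := exists_continuousOn_ae_eq_of_mem_sobolevCc hw
  exact (((hw.1 i).congr_ae hwF .rfl).comp hF (locallyIntegrableOn_lp _) hΨ).congr_ae
    (hwF.symm.fun_comp Ψ) ((hwF.symm.fun_comp (deriv Ψ)).mul .rfl)

theorem exists_sobolevCc_ae_eq_softAbs {w : LpJet p Ω} (hw : w ∈ sobolevCc p Ω) {δ : ℝ}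
    (hδ : 0 < δ) : ∃ w' ∈ sobolevCc p Ω,
      (w' none =ᵐ[volume.restrict Ω] fun x => softAbs δ (w none x)) ∧ ‖w'‖ ≤ ‖w‖ := by
  obtain ⟨w', hw', hnorm⟩ := exists_jet_ae_eq w
    (F := fun j => j.elim (fun x => softAbs δ (w none x))
      fun i x => deriv (softAbs δ) (w none x) * w (some i) x)
    (by
      have hmeas (j) := (Lp.stronglyMeasurable (w j)).aestronglyMeasurable (μ := volume.restrict Ω)
      rintro (_ | i)
      · exact (contDiff_softAbs hδ).continuous.comp_aestronglyMeasurable (hmeas none)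
      · exact ((contDiff_softAbs hδ).continuous_deriv le_rfl).comp_aestronglyMeasurable
          (hmeas none) |>.mul (hmeas (some i)))
    (by
      rintro (_ | i)
      · exact .of_forall fun x => abs_softAbs_le hδ _
      · refine .of_forall fun x => ?_
        rw [Option.elim_some, abs_mul]
        exact mul_le_of_le_one_left (abs_nonneg _) (abs_deriv_softAbs_le hδ _))
  obtain ⟨f, hf⟩ := hw.2
  have hsobolev : w' ∈ sobolev p Ω := fun i =>
    (hasWeakPartialDeriv_comp_of_mem_sobolevCc hw (contDiff_softAbs hδ) i).congr_ae
      (hw' none).symm (hw' (some i)).symm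
  refine ⟨w', ⟨hsobolev, f.compLeft ⟨softAbs δ, (contDiff_softAbs hδ).continuous⟩, ?_⟩,
    hw' none, hnorm⟩
  filter_upwards [hw' none, hf] with x hx hfx hxΩ
  rw [hx, Option.elim_none, hfx hxΩ,
    CompactlySupportedContinuousMap.compLeft_apply (softAbs_zero hδ)]
  rfl

theorem exists_nonneg_sobolevTilde {w : LpJet p Ω} (hw : w ∈ sobolevTilde p Ω) {r : ℝ}
    (hr : 0 < r) : ∃ w' ∈ sobolevTilde p Ω, 0 ≤ w' none ∧
      (∀ᵐ x ∂volume.restrict Ω, |w none x| - r ≤ w' none x) ∧ ‖w'‖ ≤ ‖w‖ + r := by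
  rw [sobolevTilde_eq_closure] at hw
  obtain ⟨v, hvmem, hvsum, hvnorm, hvw⟩ :=
    exists_hasSum_of_mem_closure (S := (sobolevCcSubmodule p Ω).toAddSubgroup) hw hr
  have hδ := hasSum_geometric_two' r
  choose v' hv'mem hv' hv'norm using fun n =>
    exists_sobolevCc_ae_eq_softAbs (hvmem n) (δ := r / 2 / 2 ^ n) (by positivity)
  have hv'sum : Summable v' := .of_norm_bounded hvsum hv'norm
  refine ⟨∑' n, v' n, hasSum_mem_sobolevTilde hv'sum.hasSum fun n =>
    sobolevCc_subset_sobolevTilde (hv'mem n), ?_, ?_, ?_⟩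
  · refine (hasSum_jet_apply hv'sum.hasSum none).nonneg fun n => ?_
    rw [← Lp.coeFn_nonneg]
    filter_upwards [hv' n] with x hx
    rw [hx]
    exact softAbs_nonneg _ _
  · refine ae_abs_sub_le_of_hasSum (hasSum_jet_apply hvw none)
      (hasSum_jet_apply hv'sum.hasSum none) (fun n => by positivity) hδ fun n => ?_
    filter_upwards [hv' n] with x hx
    rw [hx]
    exact abs_sub_le_softAbs _ _
  · exact (tsum_of_norm_bounded hvsum.hasSum hv'norm).trans hvnorm

end Truncation

section Capacity

variable {N : ℕ} {p : ℝ≥0∞} [Fact (1 ≤ p)] {Ω U V : Opens (EuclideanSpace ℝ (Fin N))}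
  {A B : Set (EuclideanSpace ℝ (Fin N))}

theorem mem_admissible_iff {w : LpJet p Ω} :
    w ∈ admissible p Ω A ↔ w ∈ sobolevTilde p Ω ∧ A ⊆ closure Ω ∧
      ∃ G, IsOpen G ∧ A ⊆ G ∧ ∀ᵐ x ∂volume.restrict Ω, x ∈ G → 1 ≤ w none x := by
  have hae {G : Set (EuclideanSpace ℝ (Fin N))} (hG : IsOpen G) :
      (∀ᵐ x ∂volume.restrict (G ∩ closure Ω ∩ Ω), 1 ≤ w none x) ↔
        ∀ᵐ x ∂volume.restrict Ω, x ∈ G → 1 ≤ w none x := by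
    rw [Set.inter_assoc, Set.inter_eq_self_of_subset_right subset_closure,
      ← Measure.restrict_restrict hG.measurableSet, ae_restrict_iff' hG.measurableSet]
  constructor
  · rintro ⟨hw, -, ⟨G, hG, rfl⟩, hAG, hwG⟩
    exact ⟨hw, hAG.trans Set.inter_subset_right, G, hG, hAG.trans Set.inter_subset_left,
      (hae hG).1 hwG⟩
  · rintro ⟨hw, hAΩ, G, hG, hAG, hwG⟩
    exact ⟨hw, G ∩ closure Ω, ⟨G, hG, rfl⟩, Set.subset_inter hAG hAΩ, (hae hG).2 hwG⟩

theorem exists_nonneg_admissible {w : LpJet p Ω} (hw : w ∈ admissible p Ω A) {c : ℝ≥0∞}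
    (hwc : ‖w‖ₑ < c) : ∃ w' ∈ admissible p Ω A, 0 ≤ w' none ∧ ‖w'‖ₑ < c := by
  obtain ⟨hw, hAΩ, G, hG, hAG, hwG⟩ := mem_admissible_iff.1 hw
  have htendsto : Tendsto (fun r : ℝ => ENNReal.ofReal ((1 - r)⁻¹ * (‖w‖ + r))) (𝓝[>] 0)
      (𝓝 ‖w‖ₑ) := by
    have hcont : ContinuousAt (fun r : ℝ => (1 - r)⁻¹ * (‖w‖ + r)) 0 := by
      fun_prop (disch := norm_num)
    simpa using (ENNReal.tendsto_ofReal hcont.tendsto).mono_left nhdsWithin_le_nhds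
  obtain ⟨r, hrc, hr1, hr0⟩ := ((htendsto.eventually_lt_const hwc).and
    ((eventually_nhdsWithin_of_eventually_nhds (eventually_lt_nhds one_pos)).and
      self_mem_nhdsWithin)).exists
  obtain ⟨v, hv, hv0, hwv, hvnorm⟩ := exists_nonneg_sobolevTilde hw hr0
  have hs : 0 < (1 - r)⁻¹ := inv_pos.2 (sub_pos.2 hr1)
  refine ⟨(1 - r)⁻¹ • v,
    mem_admissible_iff.2 ⟨smul_mem_sobolevTilde _ hv, hAΩ, G, hG, hAG, ?_⟩, ?_, ?_⟩
  · filter_upwards [hwG, hwv, Lp.coeFn_smul (1 - r)⁻¹ (v none)] with x hwx hwvx hsx hxG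
    rw [PiLp.smul_apply, hsx, Pi.smul_apply, smul_eq_mul, ← div_eq_inv_mul,
      one_le_div (sub_pos.2 hr1)]
    exact (sub_le_sub_right ((hwx hxG).trans (le_abs_self _)) r).trans hwvx
  · rw [← Lp.coeFn_nonneg] at hv0 ⊢
    filter_upwards [hv0, Lp.coeFn_smul (1 - r)⁻¹ (v none)] with x hvx hsx
    rw [PiLp.smul_apply, hsx]
    exact mul_nonneg hs.le hvx
  · refine lt_of_le_of_lt ?_ hrc
    rw [← ofReal_norm, norm_smul, Real.norm_of_nonneg hs.le]
    gcongr

/-- The `p`-th root of the relative capacity (for `p < ∞`), the infimum of the norms of the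
admissible functions. It is more convenient than `relCap` since its countable subadditivity is
the triangle inequality. -/
def relCapRoot (p : ℝ≥0∞) [Fact (1 ≤ p)] (Ω : Opens (EuclideanSpace ℝ (Fin N)))
    (A : Set (EuclideanSpace ℝ (Fin N))) : ℝ≥0∞ :=
  ⨅ w ∈ admissible p Ω A, ‖w‖ₑ

theorem relCap_eq_relCapRoot_rpow (hp : p ≠ ∞) :
    relCap p Ω A = relCapRoot p Ω A ^ p.toReal := by
  have hp0 : 0 < p.toReal := ENNReal.toReal_pos (zero_lt_one.trans_le Fact.out).ne' hp
  simpa only [relCap, relCapRoot, ENNReal.orderIsoRpow_apply] using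
    ((ENNReal.orderIsoRpow p.toReal hp0).map_iInf₂ fun w (_ : w ∈ admissible p Ω A) => ‖w‖ₑ).symm

theorem relCapRoot_mono (hAB : A ⊆ B) : relCapRoot p Ω A ≤ relCapRoot p Ω B :=
  biInf_mono fun _ ⟨hw, O, hO, hBO, hwO⟩ => ⟨hw, O, hO, hAB.trans hBO, hwO⟩

theorem relCapRoot_inter_closure_le (hUV : U ≤ V) :
    relCapRoot p U (A ∩ closure U) ≤ relCapRoot p V A := by
  refine le_iInf₂ fun w hw => ?_
  obtain ⟨hw, -, G, hG, hAG, hwG⟩ := mem_admissible_iff.1 hw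
  refine iInf₂_le_of_le (jetRestrict hUV w) (mem_admissible_iff.2
    ⟨jetRestrict_mem_sobolevTilde hUV hw, Set.inter_subset_right, G, hG,
      Set.inter_subset_left.trans hAG, ?_⟩) (enorm_le_iff_norm_le.2 (norm_jetRestrict_le hUV w))
  filter_upwards [ae_restrict_of_ae_restrict_of_subset hUV hwG, jetRestrict_apply_ae_eq hUV w none]
    with x hwx hx
  rwa [hx]

theorem exists_relCapRoot_le_mul (hUV : U ≤ V) {K : Set (EuclideanSpace ℝ (Fin N))}
    (hK : IsCompact K) (hKU : K ⊆ U) :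
    ∃ C : ℝ≥0, ∀ A ⊆ K, relCapRoot p V A ≤ C * relCapRoot p U A := by
  obtain ⟨η, hη⟩ := exists_testFunction_eventuallyEq_one hK hKU
  obtain ⟨H, hH, hKH, hηH⟩ := eventually_nhdsSet_iff_exists.1 hη
  let T : LpJet p U →L[ℝ] LpJet p V := jetMul V η
  refine ⟨‖T‖₊ + 1, fun A hAK => ?_⟩
  have hC : ((‖T‖₊ + 1 : ℝ≥0) : ℝ≥0∞) ≠ 0 := by positivity
  simp only [relCapRoot, ENNReal.mul_iInf_of_ne hC ENNReal.coe_ne_top]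
  refine le_iInf₂ fun w hw => ?_
  obtain ⟨hw, -, G, hG, hAG, hwG⟩ := mem_admissible_iff.1 hw
  refine iInf₂_le_of_le (jetMul V η w) (mem_admissible_iff.2
    ⟨jetMul_mem_sobolevTilde η hw, ((hAK.trans hKU).trans hUV).trans subset_closure,
      G ∩ (H ∩ U), hG.inter (hH.inter U.isOpen),
      Set.subset_inter hAG (hAK.trans (Set.subset_inter hKH hKU)), ?_⟩)
    ((T.le_opENorm w).trans (mul_le_mul' (ENNReal.coe_le_coe.2 le_self_add) le_rfl))
  filter_upwards [jetMul_none_ae_eq η w,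
    ae_restrict_of_ae ((ae_restrict_iff' U.isOpen.measurableSet).1 hwG)]
    with x hx hwx ⟨hxG, hxH, hxU⟩
  rw [hx, hηH x hxH, Pi.one_apply, one_mul]
  exact hwx hxU hxG

theorem relCapRoot_iUnion_le (A : ℕ → Set (EuclideanSpace ℝ (Fin N))) :
    relCapRoot p Ω (⋃ n, A n) ≤ ∑' n, relCapRoot p Ω (A n) := by
  refine ENNReal.le_of_forall_pos_le_add fun ε hε hfin => ?_
  obtain ⟨δ, hδ, hδε⟩ := ENNReal.exists_pos_sum_of_countable (ENNReal.coe_pos.2 hε).ne' ℕ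
  have hw (n) : ∃ w ∈ admissible p Ω (A n),
      0 ≤ w none ∧ ‖w‖ₑ < relCapRoot p Ω (A n) + δ n := by
    have hlt : relCapRoot p Ω (A n) < relCapRoot p Ω (A n) + δ n :=
      ENNReal.lt_add_right (ENNReal.ne_top_of_tsum_ne_top hfin.ne n)
        (ENNReal.coe_pos.2 (hδ n)).ne'
    nth_rw 1 [relCapRoot] at hlt
    simp only [iInf_lt_iff] at hlt
    obtain ⟨w, hw, hwlt⟩ := hlt
    exact exists_nonneg_admissible hw hwlt
  choose w hw hw0 hwlt using hw
  have hwsum : ∑' n, ‖w n‖ₑ ≤ ∑' n, relCapRoot p Ω (A n) + ε :=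
    (ENNReal.tsum_le_tsum fun n => (hwlt n).le).trans <|
      ENNReal.tsum_add.trans_le (add_le_add_right hδε.le _)
  have hsum : Summable w := .of_enorm (hwsum.trans_lt (by finiteness)).ne
  choose hwmem hAΩ G hG hAG hwG using fun n => mem_admissible_iff.1 (hw n)
  refine iInf₂_le_of_le (∑' n, w n) (mem_admissible_iff.2
    ⟨hasSum_mem_sobolevTilde hsum.hasSum hwmem, Set.iUnion_subset hAΩ, ⋃ n, G n,
      isOpen_iUnion hG, Set.iUnion_mono hAG, ?_⟩) ((enorm_tsum_le_tsum_enorm).trans hwsum)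
  have hle (n) : w n none ≤ (∑' n, w n) none :=
    le_hasSum (hasSum_jet_apply hsum.hasSum none) n fun m _ => hw0 m
  filter_upwards [ae_all_iff.2 hwG, ae_all_iff.2 fun n => (Lp.coeFn_le _ _).2 (hle n)]
    with x hwx hlex hxG
  obtain ⟨n, hxn⟩ := Set.mem_iUnion.1 hxG
  exact (hwx n hxn).trans (hlex n)

end Capacity

theorem exists_isCompact_iUnion_interior_eq {X : Type*} [TopologicalSpace X]
    [LocallyCompactSpace X] [SecondCountableTopology X] {U : Set X} (hU : IsOpen U) :
    ∃ K : ℕ → Set X, (∀ n, IsCompact (K n)) ∧ (∀ n, K n ⊆ U) ∧ ⋃ n, interior (K n) = U := by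
  have : LocallyCompactSpace U := hU.locallyCompactSpace
  let K := CompactExhaustion.choice U
  have hKU (n) : Subtype.val '' K n ⊆ U := Subtype.coe_image_subset U (K n)
  refine ⟨fun n => Subtype.val '' K n, fun n => (K.isCompact n).image continuous_subtype_val, hKU,
    (Set.iUnion_subset fun n => interior_subset.trans (hKU n)).antisymm fun x hx => ?_⟩
  obtain ⟨n, hn⟩ := Set.mem_iUnion.1 (K.iUnion_eq.ge (Set.mem_univ (⟨x, hx⟩ : U)))
  exact Set.mem_iUnion.2 ⟨n + 1, hU.isOpenMap_subtype_val.image_interior_subset _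
    ⟨⟨x, hx⟩, K.subset_interior_succ n hn, rfl⟩⟩

section QuasiContinuous

variable {N : ℕ} {p : ℝ≥0∞} [Fact (1 ≤ p)] {Ω U V : Opens (EuclideanSpace ℝ (Fin N))}
  {D : Set (EuclideanSpace ℝ (Fin N))} {u : D → ℝ}

theorem quasiContinuous_iff_relCapRoot (hp : p ≠ ∞) :
    QuasiContinuous p Ω u ↔ ∀ ε : ℝ≥0∞, 0 < ε → ∃ O : Set (EuclideanSpace ℝ (Fin N)),
      IsOpenInClosure Ω O ∧ relCapRoot p Ω O < ε ∧
        ContinuousOn u {x : D | (x : EuclideanSpace ℝ (Fin N)) ∉ O} := by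
  have hp0 : 0 < p.toReal := ENNReal.toReal_pos (zero_lt_one.trans_le Fact.out).ne' hp
  simp only [QuasiContinuous, relCap_eq_relCapRoot_rpow hp]
  constructor <;> intro h ε hε
  · simpa only [ENNReal.rpow_lt_rpow_iff hp0] using
      h (ε ^ p.toReal) (ENNReal.rpow_pos_of_nonneg hε hp0.le)
  · simpa only [ENNReal.lt_rpow_inv_iff hp0] using
      h (ε ^ p.toReal⁻¹) (ENNReal.rpow_pos_of_nonneg hε (inv_nonneg.2 hp0.le))

theorem QuasiContinuous.restrict (hp : p ≠ ∞) (hUV : U ≤ V) (hD : D ⊆ closure U)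
    (hu : QuasiContinuous p V u) : QuasiContinuous p U u := by
  rw [quasiContinuous_iff_relCapRoot hp] at hu ⊢
  intro ε hε
  obtain ⟨O, ⟨G, hG, rfl⟩, hcap, hcont⟩ := hu ε hε
  have hcl : (closure U : Set (EuclideanSpace ℝ (Fin N))) ⊆ closure V := closure_mono hUV
  have hGU : G ∩ closure V ∩ closure U = G ∩ closure U := by
    rw [Set.inter_assoc, Set.inter_eq_self_of_subset_right hcl]
  refine ⟨G ∩ closure U, ⟨G, hG, rfl⟩, ?_, hcont.mono fun x hx hxG => hx ⟨hxG.1, hD x.2⟩⟩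
  rw [← hGU]
  exact (relCapRoot_inter_closure_le hUV).trans_lt hcap

theorem QuasiContinuous.extend (hp : p ≠ ∞) (hUV : U ≤ V) (hD : D ⊆ U)
    (hu : QuasiContinuous p U u) : QuasiContinuous p V u := by
  rw [quasiContinuous_iff_relCapRoot hp] at hu ⊢
  intro ε hε
  obtain ⟨K, hK, hKU, hcover⟩ := exists_isCompact_iUnion_interior_eq U.isOpen
  choose C hC using fun n => exists_relCapRoot_le_mul (p := p) hUV (hK n) (hKU n)
  obtain ⟨δ, hδ, hδε⟩ := ENNReal.exists_pos_sum_of_countable hε.ne' ℕ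
  choose O hO hcap hcont using fun n => hu (δ n / C n)
    (ENNReal.div_pos (ENNReal.coe_pos.2 (hδ n)).ne' ENNReal.coe_ne_top)
  choose G hG hOG using hO
  have hGO (n) : G n ∩ interior (K n) ⊆ O n := by
    rw [hOG]
    exact Set.inter_subset_inter_right _ ((interior_subset.trans (hKU n)).trans subset_closure)
  have hAV : ⋃ n, G n ∩ interior (K n) ⊆ closure V :=
    Set.iUnion_subset fun n => Set.inter_subset_right.trans <|
      ((interior_subset.trans (hKU n)).trans hUV).trans subset_closure
  refine ⟨⋃ n, G n ∩ interior (K n), ⟨⋃ n, G n ∩ interior (K n),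
    isOpen_iUnion fun n => (hG n).inter isOpen_interior,
    (Set.inter_eq_self_of_subset_left hAV).symm⟩, ?_,
    continuousOn_of_locally_continuousOn fun x _ => ?_⟩
  · calc relCapRoot p V (⋃ n, G n ∩ interior (K n))
        ≤ ∑' n, relCapRoot p V (G n ∩ interior (K n)) := relCapRoot_iUnion_le _
      _ ≤ ∑' n, C n * relCapRoot p U (G n ∩ interior (K n)) := ENNReal.tsum_le_tsum fun n =>
          hC n _ (Set.inter_subset_right.trans interior_subset)
      _ ≤ ∑' n, (C n * (δ n / C n) : ℝ≥0∞) := ENNReal.tsum_le_tsum fun n =>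
          mul_le_mul_right ((relCapRoot_mono (hGO n)).trans (hcap n).le) _
      _ ≤ ∑' n, (δ n : ℝ≥0∞) := ENNReal.tsum_le_tsum fun n => ENNReal.mul_div_le
      _ < ε := hδε
  · obtain ⟨n, hn⟩ := Set.mem_iUnion.1 (hcover.ge (hD x.2))
    refine ⟨_, isOpen_interior.preimage continuous_subtype_val, hn, (hcont n).mono ?_⟩
    rintro y ⟨hy, hyK⟩ hyO
    rw [hOG] at hyO
    exact hy (Set.mem_iUnion.2 ⟨n, hyO.1, hyK⟩)

theorem mainTheorem10_general {N : ℕ} {p : ℝ≥0∞} [Fact (1 ≤ p)] (hp : p ≠ ∞)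
    {U V : Opens (EuclideanSpace ℝ (Fin N))} (hUV : U ≤ V) {D : Set (EuclideanSpace ℝ (Fin N))}
    (hD : D ⊆ U) (u : D → ℝ) : QuasiContinuous p U u ↔ QuasiContinuous p V u :=
  ⟨.extend hp hUV hD, .restrict hp hUV (hD.trans subset_closure)⟩

end QuasiContinuous

end RelCap

end

theorem mainTheorem10 {N : ℕ} (p : ℝ≥0∞) [Fact (1 ≤ p)] (hp : 1 < p) (hp' : p < ∞)
    (U V : Opens (EuclideanSpace ℝ (Fin N))) (hU : (U : Set (EuclideanSpace ℝ (Fin N))).Nonempty)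
    (hUV : U ≤ V) (u : ↥(U : Set (EuclideanSpace ℝ (Fin N))) → ℝ) :
    RelCap.QuasiContinuous p U u ↔ RelCap.QuasiContinuous p V u :=
  RelCap.mainTheorem10_general hp'.ne hUV subset_rfl u
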